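/- Let $n,d\ge 1$ be integers and let $C\subset\mathbb{R}^{n+d}=\mathbb{R}^n\times\mathbb{R}^d$ be a convex body, i.e. a compact convex set with nonempty interior. Put $S:=C\cap(\mathbb{Z}^n\times\mathbb{R}^d)$, let $K\subset\mathbb{R}^n$ be the image of $C$ under the projection $(z,x)\mapsto z$, and let $\mathbb{B}_\infty^n:=[-1,1]^n$. For measurable $A\subseteq\mathbb{Z}^n\times\mathbb{R}^d$ let $$\mathcal{H}_d(A):=\sum_{z\in\mathbb{Z}^n}\operatorname{vol}_d\bigl(\{x\in\mathbb{R}^d:(z,x)\in A\}\bigr)$$ be its mixed-integer volume, where $\operatorname{vol}_d$ is $d$-dimensional Lebesgue measure. Assume that there exist $z_0\in\mathbb{R}^n$, a real number $k\ge\frac{3e}{2}(n+d)$, and an integer matrix $U\in\mathbb{Z}^{n\times n}$ with $|\det U|=1$ such that $$z_0+k\,U\mathbb{B}_\infty^n\subseteq K.$$ Then there exists $y^\star\in S$ such that for every closed halfspace $H=\{y\in\mathbb{R}^{n+d}: a^{\mathsf T}y\ge c\}$ (with $a\in\mathbb{R}^{n+d}\setminus\{0\}$, $c\in\mathbb{R}$)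 with $y^\star\in H$, $$\mathcal{H}_d(S\cap H)\ \ge\ \Bigl(\frac1e-\frac{3(n+d)}{2k}\Bigr)\mathcal{H}_d(S).$$ -/

import Mathlib

open scoped Matrix

noncomputable section

namespace MixedInteger

/-- The space `ℝⁿ × ℝᵈ`; its points are pairs `y = (z, x)`. -/
abbrev Space (n d : ℕ) : Type := (Fin n → ℝ) × (Fin d → ℝ)

/-- A convex body: a compact convex set with nonempty interior. -/
structure IsConvexBody {n d : ℕ} (C : Set (Space n d)) : Prop where
  isCompact : IsCompact C
  convex : Convex ℝ C
  interior_nonempty : (interior C).Nonempty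

/-- The projection of a subset of `ℝⁿ × ℝᵈ` to `ℝⁿ`. -/
def proj {n d : ℕ} (A : Set (Space n d)) : Set (Fin n → ℝ) := Prod.fst '' A

/-- The mixed-integer lattice `ℤⁿ × ℝᵈ`, as a subset of `ℝⁿ × ℝᵈ`. -/
def lattice (n d : ℕ) : Set (Space n d) :=
  {y | ∃ z : Fin n → ℤ, ∀ i, y.1 i = (z i : ℝ)}

/-- The fiber `A_z = {x ∈ ℝᵈ : (z, x) ∈ A}` over `z ∈ ℝⁿ`. -/
def fiber {n d : ℕ} (A : Set (Space n d)) (z : Fin n → ℝ) : Set (Fin d → ℝ) :=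
  {x | (z, x) ∈ A}

/-- The mixed-integer volume: the sum over `z ∈ ℤⁿ` of the `d`-dimensional Lebesgue measure of
the fiber over `z`, a value in `[0, ∞]`. -/
def mixedVolume {n d : ℕ} (A : Set (Space n d)) : ENNReal :=
  ∑' z : Fin n → ℤ, MeasureTheory.volume (fiber A (fun i => (z i : ℝ)))

/-- A closed halfspace `{y : aᵀ y ≥ c}` with `a ≠ 0`. -/
def IsClosedHalfspace {n d : ℕ} (H : Set (Space n d)) : Prop :=
  ∃ (a : Space n d) (c : ℝ), a ≠ 0 ∧ H = {y | c ≤ a.1 ⬝ᵥ y.1 + a.2 ⬝ᵥ y.2}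

/-- The unit ball of the `ℓ_∞` norm of `ℝⁿ`, the cube `[-1, 1]ⁿ`. -/
def cube (n : ℕ) : Set (Fin n → ℝ) := {u | ∀ i, |u i| ≤ 1}

/-- The set `z₀ + k U [-1, 1]ⁿ`, for an integer matrix `U`. -/
def affineCube {n : ℕ} (z₀ : Fin n → ℝ) (k : ℝ) (U : Matrix (Fin n) (Fin n) ℤ) :
    Set (Fin n → ℝ) :=
  (fun u => z₀ + k • (U.map (fun m : ℤ => (m : ℝ)) *ᵥ u)) '' cube n

end MixedInteger

end

noncomputable section

open MeasureTheory Set Module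
open scoped Pointwise

/-! Write N = n + d and t = 1/(2k). Contracting a point of C towards a suitable point of C with
weight t shifts its projection by any prescribed vector of the cell U[-1/2, 1/2]ⁿ, up to a fixed
affine map, because tk = 1/2. Applied to the centroid c, this yields the lattice point y = (1 - t)c
+ tw (`exists_contraction_mem_lattice`).

The same contraction, applied fiberwise, compares mixed volume with volume: the mixed volume of C is
at most (1 + t)^N vol C, and that of A is at least (1 - t)^N vol B whenever (1 - t)B + tC ⊆ A. For A
the part of C in a halfspace containing y, one may take for B the part of C in a parallel halfspace,
displaced from c by t/(1 - t) times the width of C.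

Grünbaum's inequality gives the halfspace through c at least 1/e of the volume, and the slab between
the two boundaries is thin enough to carry only O(Nt) of it (`grunbaum_shift`). Bernoulli's
inequality collects all losses into 3Nt = 3N/(2k) (`centerpoint_constant_le`).

Grünbaum's inequality itself follows from Jensen's inequality for -log F, where F is the
distribution function of a linear functional on C; F is log-concave by the multiplicative
Brunn-Minkowski inequality. -/

/-! ### Brunn-Minkowski and Prékopa-Leindler on the line. -/

theorem Real.brunnMinkowski_isCompact {θ : ℝ} (h₀ : 0 < θ) (h₁ : θ < 1) {K L Z : Set ℝ}
    (hK : IsCompact K) (hL : IsCompact L) (hKn : K.Nonempty) (hLn : L.Nonempty)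
    (hZ : ∀ x ∈ K, ∀ y ∈ L, (1 - θ) * x + θ * y ∈ Z) :
    ENNReal.ofReal (1 - θ) * volume K + ENNReal.ofReal θ * volume L ≤ volume Z := by
  have vol : ∀ (r c : ℝ) (A : Set ℝ), 0 < r →
      volume ((fun x => r * x + c) '' A) = ENNReal.ofReal r * volume A := by
    intro r c A hr
    have : (fun x => r * x + c) '' A = (fun x => x + c) '' (r • A) := by
      rw [← image_smul, image_image]; rfl
    rw [this, image_add_right, measure_preimage_add_right, Measure.addHaar_smul]
    simp [abs_of_pos hr]
  -- Z contains the copies (1 - θ)K + θ min L and (1 - θ) max K + θL, which share only one point.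
  set a := sSup K
  set b := sInf L
  have ha : a ∈ K := hK.sSup_mem hKn
  have hb : b ∈ L := hL.sInf_mem hLn
  rw [← vol _ (θ * b) K (sub_pos.2 h₁), ← vol _ ((1 - θ) * a) L h₀]
  have hLm : MeasurableSet ((fun x => θ * x + (1 - θ) * a) '' L) :=
    (hL.image (by fun_prop)).measurableSet
  rw [← measure_union₀ hLm.nullMeasurableSet]
  · apply measure_mono
    rintro _ (⟨x, hx, rfl⟩ | ⟨y, hy, rfl⟩)
    · exact hZ x hx b hb
    · simpa [add_comm] using hZ a ha y hy
  · refine measure_mono_null (t := {(1 - θ) * a + θ * b}) ?_ (by simp)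
    rintro _ ⟨⟨x, hx, rfl⟩, ⟨y, hy, hxy⟩⟩
    have h1 : x ≤ a := le_csSup hK.bddAbove hx
    have h2 : b ≤ y := csInf_le hL.bddBelow hy
    simp only at hxy
    have h3 : (1 - θ) * x ≤ (1 - θ) * a := by gcongr
    have h4 : θ * b ≤ θ * y := by gcongr
    simp only [mem_singleton_iff]
    linarith

/-- Inner regularity reduces to compact subsets; inserting a fixed point of X and of Y keeps these
nonempty. -/
theorem Real.brunnMinkowski {θ : ℝ} (h₀ : 0 < θ) (h₁ : θ < 1) {X Y Z : Set ℝ}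
    (hX : MeasurableSet X) (hY : MeasurableSet Y) (hXn : X.Nonempty) (hYn : Y.Nonempty)
    (hZ : ∀ x ∈ X, ∀ y ∈ Y, (1 - θ) * x + θ * y ∈ Z) :
    ENNReal.ofReal (1 - θ) * volume X + ENNReal.ofReal θ * volume Y ≤ volume Z := by
  obtain ⟨x₀, hx₀⟩ := hXn
  obtain ⟨y₀, hy₀⟩ := hYn
  have key : ∀ K ⊆ X, IsCompact K → ∀ L ⊆ Y, IsCompact L →
      ENNReal.ofReal (1 - θ) * volume K + ENNReal.ofReal θ * volume L ≤ volume Z := by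
    intro K hKX hK L hLY hL
    refine le_trans ?_ (Real.brunnMinkowski_isCompact h₀ h₁ (hK.insert x₀) (hL.insert y₀)
      (insert_nonempty _ _) (insert_nonempty _ _) fun x hx y hy =>
        hZ x (insert_subset hx₀ hKX hx) y (insert_subset hy₀ hLY hy))
    gcongr <;> exact subset_insert _ _
  rw [hX.measure_eq_iSup_isCompact, hY.measure_eq_iSup_isCompact]
  simp only [ENNReal.mul_iSup, iSup_and']
  exact ENNReal.biSup_add_biSup_le' (p := fun K => K ⊆ X ∧ IsCompact K)
    (q := fun L => L ⊆ Y ∧ IsCompact L) ⟨∅, empty_subset _, isCompact_empty⟩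
    ⟨∅, empty_subset _, isCompact_empty⟩ fun K hK L hL => key K hK.1 hK.2 L hL.1 hL.2

theorem ENNReal.geom_mean_le_arith_mean_two {θ : ℝ} (h₀ : 0 < θ) (h₁ : θ < 1) (a b : ENNReal) :
    a ^ (1 - θ) * b ^ θ ≤ ENNReal.ofReal (1 - θ) * a + ENNReal.ofReal θ * b := by
  have h₁' : 0 < 1 - θ := sub_pos.2 h₁
  by_cases ha : a = ⊤
  · simp [ha, ENNReal.mul_top, h₁]
  by_cases hb : b = ⊤
  · simp [hb, ENNReal.mul_top, h₀]
  lift a to NNReal using ha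
  lift b to NNReal using hb
  have := Real.geom_mean_le_arith_mean2_weighted h₁'.le h₀.le a.2 b.2 (by ring)
  rw [← ENNReal.ofReal_coe_nnreal, ← ENNReal.ofReal_coe_nnreal,
    ENNReal.ofReal_rpow_of_nonneg a.coe_nonneg h₁'.le, ENNReal.ofReal_rpow_of_nonneg b.coe_nonneg h₀.le,
    ← ENNReal.ofReal_mul (by positivity), ← ENNReal.ofReal_mul h₁'.le, ← ENNReal.ofReal_mul h₀.le,
    ← ENNReal.ofReal_add (by positivity) (by positivity)]
  exact ENNReal.ofReal_le_ofReal this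

/-- With both suprema equal to 1, the superlevel sets of f and g are nonempty for exactly the same
levels s > 0, so Brunn-Minkowski applies level by level in the layer-cake formula. The arithmetic
mean so bounded dominates the geometric one. -/
theorem Real.prekopaLeindler_of_sup_eq_one {θ : ℝ} (h₀ : 0 < θ) (h₁ : θ < 1) {f g h : ℝ → ℝ}
    (hf : Measurable f) (hg : Measurable g) (hh : Measurable h)
    (hf₀ : 0 ≤ f) (hg₀ : 0 ≤ g) (hh₀ : 0 ≤ h)
    (hf₁ : ∀ x, f x ≤ 1) (hg₁ : ∀ x, g x ≤ 1)
    (hf₂ : ∀ s < 1, ∃ x, s < f x) (hg₂ : ∀ s < 1, ∃ x, s < g x)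
    (H : ∀ x y, f x ^ (1 - θ) * g y ^ θ ≤ h ((1 - θ) * x + θ * y)) :
    (∫⁻ x, ENNReal.ofReal (f x)) ^ (1 - θ) * (∫⁻ x, ENNReal.ofReal (g x)) ^ θ ≤
      ∫⁻ x, ENNReal.ofReal (h x) := by
  refine (ENNReal.geom_mean_le_arith_mean_two h₀ h₁ _ _).trans ?_
  have anti : ∀ u : ℝ → ℝ, Measurable fun s : ℝ => volume {x | s < u x} := fun u =>
    Antitone.measurable fun s t hst => measure_mono fun x hx => lt_of_le_of_lt hst hx
  rw [lintegral_eq_lintegral_meas_lt _ (.of_forall hf₀) hf.aemeasurable,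
    lintegral_eq_lintegral_meas_lt _ (.of_forall hg₀) hg.aemeasurable,
    lintegral_eq_lintegral_meas_lt _ (.of_forall hh₀) hh.aemeasurable,
    ← lintegral_const_mul _ (anti f), ← lintegral_const_mul _ (anti g),
    ← lintegral_add_left ((anti f).const_mul _)]
  refine setLIntegral_mono (anti h) fun s hs => ?_
  have hs : 0 < s := hs
  rcases lt_or_ge s 1 with hs1 | hs1
  · refine Real.brunnMinkowski h₀ h₁ (measurableSet_lt measurable_const hf)
      (measurableSet_lt measurable_const hg) (hf₂ s hs1) (hg₂ s hs1) fun x hx y hy => ?_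
    refine lt_of_lt_of_le ?_ (H x y)
    calc s = s ^ (1 - θ) * s ^ θ := by rw [← Real.rpow_add hs]; simp
      _ < _ := mul_lt_mul'' (Real.rpow_lt_rpow hs.le hx (sub_pos.2 h₁))
        (Real.rpow_lt_rpow hs.le hy h₀) (by positivity) (by positivity)
  · have e1 : {x | s < f x} = ∅ := by ext x; simpa using (hf₁ x).trans hs1
    have e2 : {x | s < g x} = ∅ := by ext x; simpa using (hg₁ x).trans hs1
    simp [e1, e2]

/-- Hypothesis and conclusion are homogeneous, so f and g can be divided by their suprema. -/
theorem Real.prekopaLeindler {θ : ℝ} (h₀ : 0 < θ) (h₁ : θ < 1) {f g h : ℝ → ℝ}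
    (hf : Measurable f) (hg : Measurable g) (hh : Measurable h)
    (hf₀ : 0 ≤ f) (hg₀ : 0 ≤ g) (hh₀ : 0 ≤ h)
    (hfb : BddAbove (range f)) (hgb : BddAbove (range g))
    (H : ∀ x y, f x ^ (1 - θ) * g y ^ θ ≤ h ((1 - θ) * x + θ * y)) :
    (∫⁻ x, ENNReal.ofReal (f x)) ^ (1 - θ) * (∫⁻ x, ENNReal.ofReal (g x)) ^ θ ≤
      ∫⁻ x, ENNReal.ofReal (h x) := by
  have h₁' : 0 < 1 - θ := sub_pos.2 h₁
  set a := ⨆ x, f x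
  set b := ⨆ x, g x
  have hfa : ∀ x, f x ≤ a := le_ciSup hfb
  have hgb' : ∀ x, g x ≤ b := le_ciSup hgb
  rcases ((hf₀ 0).trans (hfa 0)).eq_or_lt with ha | ha
  · have : ∀ x, f x = 0 := fun x => le_antisymm ((hfa x).trans ha.ge) (hf₀ x)
    simp [this, h₁']
  rcases ((hg₀ 0).trans (hgb' 0)).eq_or_lt with hb | hb
  · have : ∀ x, g x = 0 := fun x => le_antisymm ((hgb' x).trans hb.ge) (hg₀ x)
    simp [this, h₀]
  have ha' : (0 : ℝ) < a := ha
  have hb' : (0 : ℝ) < b := hb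
  have hc : 0 < a ^ (1 - θ) * b ^ θ := by positivity
  have key := Real.prekopaLeindler_of_sup_eq_one h₀ h₁ (f := fun x => f x / a)
    (g := fun x => g x / b) (h := fun x => h x / (a ^ (1 - θ) * b ^ θ))
    (hf.div_const _) (hg.div_const _) (hh.div_const _)
    (fun x => div_nonneg (hf₀ x) ha'.le) (fun x => div_nonneg (hg₀ x) hb'.le)
    (fun x => div_nonneg (hh₀ x) hc.le)
    (fun x => (div_le_one ha').2 (hfa x)) (fun x => (div_le_one hb').2 (hgb' x))
    (fun s hs => by
      obtain ⟨x, hx⟩ := exists_lt_of_lt_ciSup (show s * a < ⨆ x, f x from by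
        simpa using mul_lt_mul_of_pos_right hs ha')
      exact ⟨x, (lt_div_iff₀ ha').2 hx⟩)
    (fun s hs => by
      obtain ⟨x, hx⟩ := exists_lt_of_lt_ciSup (show s * b < ⨆ x, g x from by
        simpa using mul_lt_mul_of_pos_right hs hb')
      exact ⟨x, (lt_div_iff₀ hb').2 hx⟩)
    (fun x y => by
      rw [Real.div_rpow (hf₀ x) ha'.le, Real.div_rpow (hg₀ y) hb'.le, div_mul_div_comm]
      exact div_le_div_of_nonneg_right (H x y) hc.le)
  have div : ∀ (u : ℝ → ℝ) (c : ℝ), Measurable u → 0 < c →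
      ∫⁻ x, ENNReal.ofReal (u x) = ENNReal.ofReal c * ∫⁻ x, ENNReal.ofReal (u x / c) := by
    intro u c hu hc
    rw [← lintegral_const_mul _ (hu.div_const c).ennreal_ofReal]
    congr 1 with x
    rw [← ENNReal.ofReal_mul hc.le, mul_div_cancel₀ _ hc.ne']
  rw [div f a hf ha', div g b hg hb', div h _ hh hc, ENNReal.mul_rpow_of_nonneg _ _ h₁'.le,
    ENNReal.mul_rpow_of_nonneg _ _ h₀.le, ENNReal.ofReal_mul (by positivity),
    ← ENNReal.ofReal_rpow_of_pos ha', ← ENNReal.ofReal_rpow_of_pos hb', mul_mul_mul_comm]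
  gcongr

/-! ### Log-concavity of Haar measure, by induction on dimension. -/

/-- A measure is log-concave on compact sets if it satisfies the multiplicative form of the
Brunn-Minkowski inequality. -/
def IsLogConcaveMeasure {E : Type*} [NormedAddCommGroup E] [NormedSpace ℝ E] [MeasurableSpace E]
    (μ : Measure E) : Prop :=
  ∀ ⦃θ : ℝ⦄, 0 < θ → θ < 1 → ∀ ⦃A B C : Set E⦄, IsCompact A → IsCompact B → IsCompact C →
    (∀ x ∈ A, ∀ y ∈ B, (1 - θ) • x + θ • y ∈ C) → μ A ^ (1 - θ) * μ B ^ θ ≤ μ C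

section

variable {E F : Type*} [NormedAddCommGroup E] [NormedSpace ℝ E] [MeasurableSpace E] [BorelSpace E]
  [NormedAddCommGroup F] [NormedSpace ℝ F] [MeasurableSpace F] [BorelSpace F]

/-- The fiber measures of A, B, C satisfy the Prékopa-Leindler hypothesis, by log-concavity of μ. -/
theorem IsLogConcaveMeasure.real_prod [SecondCountableTopology E] {μ : Measure E} [SFinite μ]
    [IsFiniteMeasureOnCompacts μ] (hμ : IsLogConcaveMeasure μ) :
    IsLogConcaveMeasure ((volume : Measure ℝ).prod μ) := by
  intro θ h₀ h₁ A B C hA hB hC H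
  have fib : ∀ {A : Set (ℝ × E)}, IsCompact A → ∀ s : ℝ, IsCompact (Prod.mk s ⁻¹' A) :=
    fun {A} hA s => (hA.image continuous_snd).of_isClosed_subset
      (hA.isClosed.preimage (by fun_prop)) fun x hx => ⟨(s, x), hx, rfl⟩
  have meas : ∀ {A : Set (ℝ × E)}, IsCompact A →
      Measurable fun s : ℝ => (μ (Prod.mk s ⁻¹' A)).toReal := fun hA =>
    (measurable_measure_prodMk_left hA.measurableSet).ennreal_toReal
  have bdd : ∀ {A : Set (ℝ × E)}, IsCompact A →
      BddAbove (range fun s : ℝ => (μ (Prod.mk s ⁻¹' A)).toReal) := by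
    rintro A hA
    refine ⟨(μ (Prod.snd '' A)).toReal, ?_⟩
    rintro _ ⟨s, rfl⟩
    exact ENNReal.toReal_mono (hA.image continuous_snd).measure_ne_top
      (measure_mono fun x hx => ⟨(s, x), hx, rfl⟩)
  have eq : ∀ {A : Set (ℝ × E)}, IsCompact A → (volume : Measure ℝ).prod μ A =
      ∫⁻ s, ENNReal.ofReal (μ (Prod.mk s ⁻¹' A)).toReal := by
    intro A hA
    rw [Measure.prod_apply hA.measurableSet]
    congr 1 with s
    rw [ENNReal.ofReal_toReal (fib hA s).measure_ne_top]
  rw [eq hA, eq hB, eq hC]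
  refine Real.prekopaLeindler h₀ h₁ (meas hA) (meas hB) (meas hC) (fun _ => ENNReal.toReal_nonneg)
    (fun _ => ENNReal.toReal_nonneg) (fun _ => ENNReal.toReal_nonneg) (bdd hA) (bdd hB)
    fun s t => ?_
  rw [ENNReal.toReal_rpow, ENNReal.toReal_rpow, ← ENNReal.toReal_mul]
  refine ENNReal.toReal_mono (fib hC _).measure_ne_top
    (hμ h₀ h₁ (fib hA s) (fib hB t) (fib hC _) fun x hx y hy => ?_)
  exact H _ hx _ hy

/-- Haar measures correspond up to a constant, which cancels because the exponents 1 - θ and θ sum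
to 1. -/
theorem IsLogConcaveMeasure.of_linearEquiv [FiniteDimensional ℝ E] [FiniteDimensional ℝ F]
    {μ : Measure E} {ν : Measure F} [μ.IsAddHaarMeasure] [ν.IsAddHaarMeasure] (e : E ≃ₗ[ℝ] F)
    (hν : IsLogConcaveMeasure ν) : IsLogConcaveMeasure μ := by
  let L := e.toContinuousLinearEquiv
  have hL : (μ.map L).IsAddHaarMeasure := L.isAddHaarMeasure_map μ
  obtain ⟨c, hc⟩ : ∃ c : NNReal, μ.map L = c • ν :=
    ⟨_, Measure.isAddLeftInvariant_eq_smul _ _⟩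
  have eq : ∀ A : Set E, IsCompact A → μ A = c * ν (L '' A) := by
    intro A hA
    have : (μ.map L) (L '' A) = μ A := by
      rw [Measure.map_apply L.continuous.measurable (hA.image L.continuous).measurableSet,
        preimage_image_eq _ L.injective]
    rw [← this, hc]; rfl
  intro θ h₀ h₁ A B C hA hB hC H
  have h₁' : 0 < 1 - θ := sub_pos.2 h₁
  rw [eq A hA, eq B hB, eq C hC, ENNReal.mul_rpow_of_nonneg _ _ h₁'.le,
    ENNReal.mul_rpow_of_nonneg _ _ h₀.le, mul_mul_mul_comm,
    ← ENNReal.rpow_add_of_nonneg _ _ h₁'.le h₀.le, sub_add_cancel, ENNReal.rpow_one]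
  gcongr
  refine hν h₀ h₁ (hA.image L.continuous) (hB.image L.continuous) (hC.image L.continuous) ?_
  rintro _ ⟨x, hx, rfl⟩ _ ⟨y, hy, rfl⟩
  exact ⟨_, H x hx y hy, by simp⟩

theorem isLogConcaveMeasure_pi (n : ℕ) :
    IsLogConcaveMeasure (volume : Measure (Fin n → ℝ)) := by
  induction n with
  | zero =>
    intro θ h₀ h₁ A B C hA hB hC H
    have h₁' : 0 < 1 - θ := sub_pos.2 h₁
    rcases A.eq_empty_or_nonempty with rfl | ⟨x, hx⟩
    · simp [h₁']
    rcases B.eq_empty_or_nonempty with rfl | ⟨y, hy⟩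
    · simp [h₀]
    rw [Subsingleton.eq_univ_of_nonempty ⟨x, hx⟩, Subsingleton.eq_univ_of_nonempty ⟨y, hy⟩,
      Subsingleton.eq_univ_of_nonempty ⟨_, H x hx y hy⟩]
    simp [volume_pi]
  | succ n ih =>
    exact ih.real_prod.of_linearEquiv
      (LinearEquiv.ofFinrankEq _ _ (by simp [add_comm]))

theorem isLogConcaveMeasure_addHaar [FiniteDimensional ℝ E] (μ : Measure E) [μ.IsAddHaarMeasure] :
    IsLogConcaveMeasure μ :=
  (isLogConcaveMeasure_pi (finrank ℝ E)).of_linearEquiv (LinearEquiv.ofFinrankEq _ _ (by simp))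

end

/-! ### Log-concave distributions on the line. -/

theorem ConvexOn.exists_subgradient {S : Set ℝ} {f : ℝ → ℝ} (hf : ConvexOn ℝ S f) {x : ℝ}
    (hx : x ∈ interior S) : ∃ b : ℝ, ∀ y ∈ S, f x + b * (y - x) ≤ f y := by
  refine ⟨derivWithin f (Iio x) x, fun y hy => ?_⟩
  rcases lt_trichotomy y x with h | rfl | h
  · have := hf.slope_le_leftDeriv_of_mem_interior hy hx h
    rw [slope_def_field, div_le_iff₀ (sub_pos.2 h)] at this
    linarith
  · simp
  · have := (hf.leftDeriv_le_rightDeriv_of_mem_interior hx).trans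
      (hf.rightDeriv_le_slope_of_mem_interior hx hy h)
    rw [slope_def_field, le_div_iff₀ (sub_pos.2 h)] at this
    linarith

section

variable (μ : Measure ℝ) [IsProbabilityMeasure μ]

theorem monotone_real_Iic : Monotone fun x => μ.real (Iic x) := fun _ _ h =>
  measureReal_mono (Iic_subset_Iic.2 h)

/-- F(X) stochastically dominates a uniform variable: a compact subset of {F < u} lies below its
maximum, where F is still less than u. -/
theorem measure_real_Iic_lt_le (u : ℝ) :
    μ {x | μ.real (Iic x) < u} ≤ ENNReal.ofReal u := by
  have hm : MeasurableSet {x | μ.real (Iic x) < u} :=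
    measurableSet_lt (monotone_real_Iic μ).measurable measurable_const
  rw [hm.measure_eq_iSup_isCompact]
  refine iSup₂_le fun K hK => iSup_le fun hKc => ?_
  rcases K.eq_empty_or_nonempty with rfl | hn
  · simp
  have hmax := hK (hKc.sSup_mem hn)
  calc μ K ≤ μ (Iic (sSup K)) := measure_mono fun x hx => le_csSup hKc.bddAbove hx
    _ = ENNReal.ofReal (μ.real (Iic (sSup K))) := (ofReal_measureReal (measure_ne_top _ _)).symm
    _ ≤ ENNReal.ofReal u := ENNReal.ofReal_le_ofReal (le_of_lt hmax)

theorem ae_real_Iic_pos : ∀ᵐ x ∂μ, 0 < μ.real (Iic x) := by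
  have h : μ {x | ¬ 0 < μ.real (Iic x)} = 0 := by
    have key : ∀ u : ℝ, 0 < u → μ {x | ¬ 0 < μ.real (Iic x)} ≤ ENNReal.ofReal u := fun u hu =>
      (measure_mono fun x hx => lt_of_le_of_lt (not_lt.1 hx) hu).trans (measure_real_Iic_lt_le μ u)
    refine le_antisymm (ENNReal.le_of_forall_pos_le_add fun ε hε _ => ?_) zero_le
    simpa using key ε hε
  exact h

/-- By the uniform domination, -log F(X) has tail at most exp(-t), like a standard exponential
variable. -/
theorem lintegral_neg_log_real_Iic_le :
    ∫⁻ x, ENNReal.ofReal (-Real.log (μ.real (Iic x))) ∂μ ≤ 1 := by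
  have hmeas : Measurable fun x => -Real.log (μ.real (Iic x)) :=
    (Real.measurable_log.comp (monotone_real_Iic μ).measurable).neg
  rw [lintegral_eq_lintegral_meas_lt μ (.of_forall fun x => neg_nonneg.2
    (Real.log_nonpos measureReal_nonneg measureReal_le_one)) hmeas.aemeasurable]
  calc ∫⁻ t in Ioi 0, μ {x | t < -Real.log (μ.real (Iic x))}
      ≤ ∫⁻ t in Ioi (0 : ℝ), ENNReal.ofReal (Real.exp (-t)) := by
        refine setLIntegral_mono (by fun_prop) fun t ht => ?_
        refine (measure_mono fun x hx => ?_).trans (measure_real_Iic_lt_le μ _)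
        have ht : 0 < t := ht
        have hx : t < -Real.log (μ.real (Iic x)) := hx
        -- Since `Real.log 0 = 0`, a zero of F would contradict t > 0.
        have hpos : 0 < μ.real (Iic x) := by
          rcases (measureReal_nonneg (μ := μ) (s := Iic x)).eq_or_lt with h | h
          · rw [← h] at hx; simp at hx; linarith
          · exact h
        exact (Real.log_lt_iff_lt_exp hpos).1 (by linarith)
    _ = 1 := by
        rw [← ofReal_integral_eq_lintegral_ofReal (integrableOn_exp_neg_Ioi 0)
          (.of_forall fun t => (Real.exp_pos _).le), integral_exp_neg_Ioi_zero]
        simp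

/-- A log-concave distribution on the line puts mass at least `1 / e` below its mean. -/
theorem exp_neg_one_le_real_Iic_integral (hint : Integrable (fun x => x) μ)
    (hlc : ∀ θ : ℝ, 0 < θ → θ < 1 → ∀ x y : ℝ,
      μ.real (Iic x) ^ (1 - θ) * μ.real (Iic y) ^ θ ≤ μ.real (Iic ((1 - θ) * x + θ * y))) :
    Real.exp (-1) ≤ μ.real (Iic (∫ x, x ∂μ)) := by
  set m := ∫ x, x ∂μ with hm
  -- Mass below the mean puts m in the interior of {F > 0}, where -log F has a subgradient.
  -- Otherwise the law is a point mass at m and F(m) = 1.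
  by_cases hcase : ∃ τ < m, 0 < μ.real (Iic τ)
  · obtain ⟨τ, hτ, hFτ⟩ := hcase
    have hD : ∀ x, τ ≤ x → 0 < μ.real (Iic x) := fun x hx =>
      hFτ.trans_le (monotone_real_Iic μ hx)
    have hconv : ConvexOn ℝ {x | 0 < μ.real (Iic x)} fun x => -Real.log (μ.real (Iic x)) := by
      have aux : ∀ x, 0 < μ.real (Iic x) → ∀ y, 0 < μ.real (Iic y) → ∀ a b : ℝ, 0 < a → 0 < b →
          a + b = 1 → 0 < μ.real (Iic x) ^ a * μ.real (Iic y) ^ b ∧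
            μ.real (Iic x) ^ a * μ.real (Iic y) ^ b ≤ μ.real (Iic (a * x + b * y)) := by
        intro x hx y hy a b ha hb hab
        obtain rfl : a = 1 - b := by linarith
        exact ⟨by positivity, hlc b hb (by linarith) x y⟩
      rw [convexOn_iff_forall_pos]
      refine ⟨convex_iff_forall_pos.2 fun x hx y hy a b ha hb hab => ?_,
        fun x hx y hy a b ha hb hab => ?_⟩
      · obtain ⟨h1, h2⟩ := aux x hx y hy a b ha hb hab
        exact h1.trans_le h2
      · obtain ⟨h1, h2⟩ := aux x hx y hy a b ha hb hab
        have hx : 0 < μ.real (Iic x) := hx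
        have hy : 0 < μ.real (Iic y) := hy
        have h3 := Real.log_le_log h1 h2
        rw [Real.log_mul (by positivity) (by positivity), Real.log_rpow hx, Real.log_rpow hy] at h3
        simp only [smul_eq_mul]
        linarith
    have hmem : m ∈ interior {x | 0 < μ.real (Iic x)} :=
      mem_interior.2 ⟨Ioi τ, fun x hx => hD x (le_of_lt hx), isOpen_Ioi, hτ⟩
    obtain ⟨b, hb⟩ := hconv.exists_subgradient hmem
    have hmeas : Measurable fun x => -Real.log (μ.real (Iic x)) :=
      (Real.measurable_log.comp (monotone_real_Iic μ).measurable).neg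
    have hnn : ∀ x, 0 ≤ -Real.log (μ.real (Iic x)) := fun x => neg_nonneg.2
      (Real.log_nonpos measureReal_nonneg measureReal_le_one)
    have hlint := lintegral_neg_log_real_Iic_le μ
    have hgi : Integrable (fun x => -Real.log (μ.real (Iic x))) μ :=
      ⟨hmeas.aestronglyMeasurable, by
        rw [hasFiniteIntegral_iff_ofReal (.of_forall hnn)]
        exact hlint.trans_lt ENNReal.one_lt_top⟩
    have h1 : ∫ x, -Real.log (μ.real (Iic x)) ∂μ ≤ 1 := by
      rw [integral_eq_lintegral_of_nonneg_ae (.of_forall hnn) hmeas.aestronglyMeasurable]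
      exact ENNReal.toReal_le_of_le_ofReal zero_le_one (by simpa using hlint)
    have hli : Integrable (fun x => b * (x - m)) μ := (hint.sub (integrable_const m)).const_mul b
    -- Jensen's inequality: the linear term integrates to 0, leaving -log F(m) ≤ 1. The subgradient
    -- bound is known only where F > 0, which is almost everywhere.
    have h2 : ∫ x, (-Real.log (μ.real (Iic m)) + b * (x - m)) ∂μ ≤
        ∫ x, -Real.log (μ.real (Iic x)) ∂μ := by
      refine integral_mono_ae ((integrable_const _).add hli) hgi ?_
      filter_upwards [ae_real_Iic_pos μ] with x hx using hb x hx
    rw [integral_add (integrable_const _) hli, integral_const_mul,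
      integral_sub hint (integrable_const m), ← hm] at h2
    simp at h2
    exact (Real.le_log_iff_exp_le (hD m hτ.le)).1 (by linarith)
  · push Not at hcase
    have h0 : ∀ᵐ x ∂μ, m ≤ x := by
      filter_upwards [ae_real_Iic_pos μ] with x hx
      by_contra! h
      exact absurd hx (hcase x h).not_gt
    have h1 : ∫ x, (x - m) ∂μ = 0 := by
      rw [integral_sub hint (integrable_const m), ← hm]; simp
    have h2 := (integral_eq_zero_iff_of_nonneg_ae (by
      filter_upwards [h0] with x hx using sub_nonneg.2 hx) (hint.sub (integrable_const m))).1 h1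
    have h3 : μ (Iic m) = 1 := by
      rw [← prob_compl_eq_zero_iff measurableSet_Iic]
      filter_upwards [h2] with x hx
      simp only [Pi.zero_apply] at hx
      exact (sub_eq_zero.1 hx).le
    simp [Measure.real, h3]

end

/-! ### Grünbaum's inequality. -/

section

variable {E : Type*} [NormedAddCommGroup E] [NormedSpace ℝ E] [MeasurableSpace E] [BorelSpace E]
  [FiniteDimensional ℝ E]

/-- **Grünbaum's inequality**, with the dimension-free constant `1 / e`. -/
theorem grunbaum (μ : Measure E) [μ.IsAddHaarMeasure] {C : Set E} (hC : IsCompact C)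
    (hconv : Convex ℝ C) (h₀ : μ C ≠ 0) (l : E →L[ℝ] ℝ) :
    Real.exp (-1) * μ.real C ≤ μ.real (C ∩ {y | l y ≤ l (⨍ x in C, x ∂μ)}) := by
  have hCt : μ C ≠ ⊤ := hC.measure_ne_top
  set ν : Measure E := (μ C)⁻¹ • μ.restrict C with hν
  have hpν : IsProbabilityMeasure ν := by
    constructor
    simp [hν, ENNReal.inv_mul_cancel h₀ hCt]
  have hpm : IsProbabilityMeasure (ν.map l) :=
    Measure.isProbabilityMeasure_map l.continuous.measurable.aemeasurable
  have hpos : 0 < μ.real C := ENNReal.toReal_pos h₀ hCt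
  have hreal : ∀ τ, (ν.map l).real (Iic τ) = (μ.real C)⁻¹ * μ.real (C ∩ {y | l y ≤ τ}) := by
    intro τ
    have hm : MeasurableSet (l ⁻¹' Iic τ) := l.continuous.measurable measurableSet_Iic
    rw [Measure.real, Measure.map_apply l.continuous.measurable measurableSet_Iic, hν,
      Measure.smul_apply, Measure.restrict_apply hm, smul_eq_mul, ENNReal.toReal_mul,
      ENNReal.toReal_inv, inter_comm]
    rfl
  have hid : IntegrableOn (fun x : E => x) C μ := continuousOn_id.integrableOn_compact hC
  have hidν : Integrable (fun x : E => x) ν := by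
    rw [hν]; exact Integrable.smul_measure hid (ENNReal.inv_ne_top.2 h₀)
  have hmean : ∫ x, x ∂(ν.map l) = l (⨍ x in C, x ∂μ) := by
    rw [integral_map l.continuous.measurable.aemeasurable (by fun_prop),
      ContinuousLinearMap.integral_comp_comm l hidν, average, Measure.restrict_apply_univ]
  have key := exp_neg_one_le_real_Iic_integral (ν.map l)
    ((integrable_map_measure (by fun_prop) l.continuous.measurable.aemeasurable).2
      (l.integrable_comp hidν)) (by
      intro θ h₀ h₁ x y
      have hcl : ∀ τ, IsCompact (C ∩ {y | l y ≤ τ}) := fun τ =>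
        hC.inter_right (isClosed_le l.continuous continuous_const)
      -- By convexity, combinations of sublevel parts of C stay in the sublevel part for the
      -- combined threshold.
      have hc := isLogConcaveMeasure_addHaar μ h₀ h₁ (hcl x) (hcl y) (hcl ((1 - θ) * x + θ * y))
        (by
          rintro u ⟨hu, hux⟩ v ⟨hv, hvy⟩
          refine ⟨hconv hu hv (by linarith) h₀.le (by ring), ?_⟩
          have hux : l u ≤ x := hux
          have hvy : l v ≤ y := hvy
          have h₁' : 0 < 1 - θ := by linarith
          simp only [mem_ofPred_eq, map_add, map_smul, smul_eq_mul]
          gcongr)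
      have hc' := ENNReal.toReal_mono (hcl _).measure_ne_top hc
      rw [ENNReal.toReal_mul, ← ENNReal.toReal_rpow, ← ENNReal.toReal_rpow] at hc'
      have h₁' : 0 < 1 - θ := by linarith
      have hi : 0 ≤ (μ.real C)⁻¹ := by positivity
      rw [hreal, hreal, hreal, Real.mul_rpow hi measureReal_nonneg,
        Real.mul_rpow hi measureReal_nonneg, mul_mul_mul_comm, ← Real.rpow_add (by positivity)]
      simp only [sub_add_cancel, Real.rpow_one]
      exact mul_le_mul_of_nonneg_left hc' hi)
  rw [hmean, hreal] at key
  rwa [← le_div_iff₀ hpos, div_eq_inv_mul]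

end

/-! ### Volume of thin slabs, and halfspaces displaced from the centroid. -/

section

variable {E : Type*} [NormedAddCommGroup E] [NormedSpace ℝ E] [MeasurableSpace E] [BorelSpace E]
  [FiniteDimensional ℝ E] (μ : Measure E) [μ.IsAddHaarMeasure]

theorem ofReal_pow_finrank_mul_addHaar_le {ε : ℝ} (hε : ε ≤ 1) {A B : Set E} (v : E)
    (h : ∀ w ∈ A, (1 - ε) • w + ε • v ∈ B) :
    ENNReal.ofReal ((1 - ε) ^ finrank ℝ E) * μ A ≤ μ B := by
  have h' : 0 ≤ 1 - ε := sub_nonneg.2 hε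
  rw [← abs_of_nonneg (pow_nonneg h' _), ← Measure.addHaar_image_homothety μ v]
  refine measure_mono ?_
  rintro _ ⟨w, hw, rfl⟩
  convert! h w hw using 1
  rw [AffineMap.homothety_apply, vsub_eq_sub, vadd_eq_add]
  module

theorem addHaar_real_sub_le_of_contraction {ε : ℝ} (hε : ε ≤ 1) {A B : Set E}
    (hA : μ A ≠ ⊤) (hBA : B ⊆ A) (v : E) (h : ∀ w ∈ A, (1 - ε) • w + ε • v ∈ B) :
    μ.real A - μ.real B ≤ finrank ℝ E * ε * μ.real A := by
  have h1 := ENNReal.toReal_mono (measure_ne_top_of_subset hBA hA)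
    (ofReal_pow_finrank_mul_addHaar_le μ hε v h)
  rw [ENNReal.toReal_mul, ENNReal.toReal_ofReal (pow_nonneg (sub_nonneg.2 hε) _)] at h1
  have h2 := one_add_mul_le_pow (show (-2 : ℝ) ≤ -ε by linarith) (finrank ℝ E)
  have h3 : (1 + finrank ℝ E * -ε) * μ.real A ≤ (1 + -ε) ^ finrank ℝ E * μ.real A :=
    mul_le_mul_of_nonneg_right h2 measureReal_nonneg
  rw [← sub_eq_add_neg 1 ε] at h3
  change (1 - ε) ^ finrank ℝ E * μ.real A ≤ μ.real B at h1
  linarith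

/-- Contraction with ε = δ/a, stated without division so that estimates for different a can be
added; for a ≤ δ the bound is trivial. -/
theorem addHaar_real_sub_mul_le {a δ : ℝ} (hδ : 0 ≤ δ) (hN : 0 < finrank ℝ E) {A B : Set E}
    (hA : μ A ≠ ⊤) (hBA : B ⊆ A) (v : E)
    (h : ∀ ε : ℝ, 0 ≤ ε → ε < 1 → ε * a = δ → ∀ w ∈ A, (1 - ε) • w + ε • v ∈ B) :
    (μ.real A - μ.real B) * a ≤ finrank ℝ E * δ * μ.real A := by
  have hN' : (1 : ℝ) ≤ finrank ℝ E := by exact_mod_cast hN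
  have hd : 0 ≤ μ.real A - μ.real B := sub_nonneg.2 (measureReal_mono hBA hA)
  have hd' : μ.real A - μ.real B ≤ μ.real A := sub_le_self _ measureReal_nonneg
  rcases le_or_gt a δ with ha | ha
  · calc _ ≤ μ.real A * δ :=
        (mul_le_mul_of_nonneg_left ha hd).trans (mul_le_mul_of_nonneg_right hd' hδ)
      _ ≤ _ := by nlinarith [mul_nonneg hδ (measureReal_nonneg (μ := μ) (s := A))]
  · have ha0 : 0 < a := hδ.trans_lt ha
    have hε : δ / a < 1 := (div_lt_one ha0).2 ha
    have := addHaar_real_sub_le_of_contraction μ hε.le hA hBA v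
      (h (δ / a) (by positivity) hε (div_mul_cancel₀ _ ha0.ne'))
    calc _ ≤ finrank ℝ E * (δ / a) * μ.real A * a := mul_le_mul_of_nonneg_right this ha0.le
      _ = _ := by field_simp

/-- A slab of relative width `s` in a convex body carries little of its volume. -/
theorem addHaar_real_slab_le (hN : 0 < finrank ℝ E) {C : Set E} (hC : IsCompact C)
    (hconv : Convex ℝ C) (l : E →L[ℝ] ℝ) {u v : E} (hu : u ∈ C) (hv : v ∈ C)
    (huv : l u ≤ l v) {s α : ℝ} (hs : 0 ≤ s) :
    μ.real (C ∩ {y | α ≤ l y ∧ l y < α + s * (l v - l u)}) * (1 + s - finrank ℝ E * s) ≤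
      finrank ℝ E * s * μ.real C := by
  set W := l v - l u with hW
  have hW0 : 0 ≤ W := sub_nonneg.2 huv
  rcases hW0.eq_or_lt with hW1 | hW1
  · have : C ∩ {y | α ≤ l y ∧ l y < α + s * W} = ∅ := by
      ext y; simp [← hW1]
    rw [this]
    simp only [measureReal_empty, zero_mul]
    positivity
  set β := α + s * W with hβ
  set D := C ∩ {y | α ≤ l y ∧ l y < β} with hD
  have hlm : Measurable l := l.continuous.measurable
  have hfin : ∀ P : E → Prop, μ (C ∩ {y | P y}) ≠ ⊤ := fun P =>
    measure_ne_top_of_subset inter_subset_left hC.measure_ne_top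
  have hDm : MeasurableSet D := hC.measurableSet.inter
    ((measurableSet_le measurable_const hlm).inter (measurableSet_lt hlm measurable_const))
  have hαβ : α ≤ β := by rw [hβ]; nlinarith
  have hsplit1 : μ.real (C ∩ {y | α ≤ l y}) = μ.real D + μ.real (C ∩ {y | β ≤ l y}) := by
    rw [← measureReal_union _ (hC.measurableSet.inter (measurableSet_le measurable_const hlm))
      (hfin _) (hfin _)]
    · congr 1
      ext y
      simp only [mem_inter_iff, mem_ofPred_eq, mem_union]
      constructor
      · rintro ⟨h1, h2⟩
        rcases lt_or_ge (l y) β with h | h <;> tauto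
      · rintro (h | h)
        · tauto
        · exact ⟨h.1, hαβ.trans h.2⟩
    · rw [Set.disjoint_left]
      rintro y ⟨_, _, h⟩ ⟨_, h'⟩
      exact not_lt_of_ge h' h
  have hsplit2 : μ.real (C ∩ {y | l y < β}) = μ.real (C ∩ {y | l y < α}) + μ.real D := by
    rw [← measureReal_union _ hDm (hfin _) (hfin _)]
    · congr 1
      ext y
      simp only [hD, mem_inter_iff, mem_ofPred_eq, mem_union]
      constructor
      · rintro ⟨h1, h2⟩
        rcases lt_or_ge (l y) α with h | h <;> tauto
      · rintro (h | h)
        · exact ⟨h.1, h.2.trans_le hαβ⟩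
        · tauto
    · rw [Set.disjoint_left]
      rintro y ⟨_, h⟩ ⟨_, h', _⟩
      exact not_lt_of_ge (show α ≤ l y from h') (show l y < α from h)
  have hsplit3 : μ.real C = μ.real (C ∩ {y | l y < α}) + μ.real (C ∩ {y | α ≤ l y}) := by
    rw [← measureReal_union _ (hC.measurableSet.inter (measurableSet_le measurable_const hlm))
      (hfin _) (hfin _)]
    · congr 1
      ext y
      simp only [mem_inter_iff, mem_ofPred_eq, mem_union]
      have := lt_or_ge (l y) α
      tauto
    · rw [Set.disjoint_left]
      rintro y ⟨_, h⟩ ⟨_, h'⟩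
      exact not_lt_of_ge (show α ≤ l y from h') (show l y < α from h)
  -- Contracting the part above α towards v pushes it above β; below, the part under β is contracted
  -- towards u. Adding the two estimates makes the position of the slab cancel, leaving the width W.
  have h1 := addHaar_real_sub_mul_le μ (a := l v - α) (δ := β - α) (sub_nonneg.2 hαβ) hN
    (A := C ∩ {y | α ≤ l y}) (B := C ∩ {y | β ≤ l y}) (hfin _)
    (fun y hy => ⟨hy.1, hαβ.trans hy.2⟩) v (by
      rintro ε h0 h1 h2 w ⟨hw, hwα⟩
      have hwα : α ≤ l w := hwα
      refine ⟨hconv hw hv (by linarith) h0 (by ring), ?_⟩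
      simp only [mem_ofPred_eq, map_add, map_smul, smul_eq_mul]
      nlinarith)
  have h2 := addHaar_real_sub_mul_le μ (a := β - l u) (δ := β - α) (sub_nonneg.2 hαβ) hN
    (A := C ∩ {y | l y < β}) (B := C ∩ {y | l y < α}) (hfin _)
    (fun y hy => ⟨hy.1, hy.2.trans_le hαβ⟩) u (by
      rintro ε h0 h1 h2 w ⟨hw, hwβ⟩
      have hwβ : l w < β := hwβ
      refine ⟨hconv hw hu (by linarith) h0 (by ring), ?_⟩
      simp only [mem_ofPred_eq, map_add, map_smul, smul_eq_mul]
      nlinarith)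
  have e1 : μ.real (C ∩ {y | α ≤ l y}) - μ.real (C ∩ {y | β ≤ l y}) = μ.real D := by linarith
  have e2 : μ.real (C ∩ {y | l y < β}) - μ.real (C ∩ {y | l y < α}) = μ.real D := by linarith
  have e3 : μ.real (C ∩ {y | α ≤ l y}) + μ.real (C ∩ {y | l y < β}) = μ.real C + μ.real D := by
    linarith
  rw [e1] at h1
  rw [e2] at h2
  have h3 : μ.real D * ((l v - l u) + (β - α)) ≤
      finrank ℝ E * (β - α) * (μ.real C + μ.real D) := by
    rw [← e3]; linarith
  have e4 : β - α = s * W := by rw [hβ]; ring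
  rw [e4, ← hW] at h3
  refine le_of_mul_le_mul_left ?_ hW1
  linarith

/-- Grünbaum's inequality for -l bounds the halfspace through the centroid; the slab is then
removed. -/
theorem grunbaum_shift (hN : 0 < finrank ℝ E) {C : Set E} (hC : IsCompact C)
    (hconv : Convex ℝ C) (h₀ : μ C ≠ 0) (l : E →L[ℝ] ℝ) {u v : E} (hu : u ∈ C) (hv : v ∈ C)
    (huv : l u ≤ l v) {s : ℝ} (hs : 0 ≤ s)
    (hs' : finrank ℝ E * s < 1 + s) :
    (Real.exp (-1) - finrank ℝ E * s / (1 + s - finrank ℝ E * s)) * μ.real C ≤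
      μ.real (C ∩ {y | l (⨍ x in C, x ∂μ) + s * (l v - l u) ≤ l y}) := by
  set α := l (⨍ x in C, x ∂μ)
  have hW0 : 0 ≤ l v - l u := sub_nonneg.2 huv
  have h1 := grunbaum μ hC hconv h₀ (-l)
  simp only [neg_apply, neg_le_neg_iff] at h1
  have h2 := addHaar_real_slab_le μ hN hC hconv l hu hv huv (α := α) hs
  rw [← le_div_iff₀ (by linarith)] at h2
  have h3 : μ.real (C ∩ {y | α ≤ l y}) ≤
      μ.real (C ∩ {y | α ≤ l y ∧ l y < α + s * (l v - l u)}) +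
        μ.real (C ∩ {y | α + s * (l v - l u) ≤ l y}) := by
    refine (measureReal_mono ?_ (measure_ne_top_of_subset (union_subset inter_subset_left
      inter_subset_left) hC.measure_ne_top)).trans (measureReal_union_le _ _)
    rintro y ⟨hy, hy'⟩
    rcases lt_or_ge (l y) (α + s * (l v - l u)) with h | h
    · exact Or.inl ⟨hy, hy', h⟩
    · exact Or.inr ⟨hy, h⟩
  rw [sub_mul, div_mul_eq_mul_div]
  linarith

end

/-! ### Tiling by integer translates of the cube, and volume-preserving matrices. -/

section

variable {n : ℕ}

/-- The half-open cube `[-1/2, 1/2)ⁿ`. -/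
def centeredCube (n : ℕ) : Set (Fin n → ℝ) := Set.pi univ fun _ => Ico (-(1 / 2)) (1 / 2)

theorem measurableSet_centeredCube : MeasurableSet (centeredCube n) :=
  MeasurableSet.univ_pi fun _ => measurableSet_Ico

theorem volume_centeredCube : volume (centeredCube n) = 1 := by
  rw [centeredCube, Real.volume_pi_Ico]
  norm_num

theorem lintegral_eq_tsum_centeredCube (f : (Fin n → ℝ) → ENNReal) :
    ∫⁻ p, f p = ∑' z : Fin n → ℤ, ∫⁻ q in centeredCube n, f ((fun i => (z i : ℝ)) + q) := by
  let s : (Fin n → ℤ) → Set (Fin n → ℝ) := fun z =>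
    (fun p => -(fun i => (z i : ℝ)) + p) ⁻¹' centeredCube n
  -- The cell of p is found by rounding each coordinate, so the cells partition the space.
  have hs : ∀ z p, p ∈ s z ↔ ∀ i, z i = ⌊p i + 1 / 2⌋ := by
    intro z p
    simp only [s, centeredCube, mem_preimage, Set.mem_pi, mem_univ, forall_const, mem_Ico,
      Pi.add_apply, Pi.neg_apply]
    refine forall_congr' fun i => ?_
    rw [eq_comm, Int.floor_eq_iff]
    constructor <;> rintro ⟨h1, h2⟩ <;> constructor <;> linarith
  have hsm : ∀ z, MeasurableSet (s z) := fun z =>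
    measurableSet_centeredCube.preimage (measurable_const_add _)
  have hu : ⋃ z, s z = univ := by
    ext p
    simp only [mem_iUnion, mem_univ, iff_true]
    exact ⟨fun i => ⌊p i + 1 / 2⌋, (hs _ _).2 fun i => rfl⟩
  have hd : Pairwise (Function.onFun Disjoint s) := by
    intro z z' hzz
    rw [Function.onFun, Set.disjoint_left]
    intro p hp hp'
    exact hzz (funext fun i => ((hs _ _).1 hp i).trans ((hs _ _).1 hp' i).symm)
  rw [← setLIntegral_univ, ← hu, lintegral_iUnion hsm hd]
  congr 1 with z
  have := (measurePreserving_add_left volume (-(fun i => (z i : ℝ)))).setLIntegral_comp_preimage_emb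
    (measurableEmbedding_addLeft _) (fun q => f ((fun i => (z i : ℝ)) + q)) (centeredCube n)
  rw [← this]
  simp [s]

theorem mul_tsum_le_lintegral (c : ENNReal) (g : (Fin n → ℤ) → ENNReal) (f : (Fin n → ℝ) → ENNReal)
    (h : ∀ z, ∀ q ∈ centeredCube n, c * g z ≤ f ((fun i => (z i : ℝ)) + q)) :
    c * ∑' z, g z ≤ ∫⁻ p, f p := by
  rw [lintegral_eq_tsum_centeredCube, ← ENNReal.tsum_mul_left]
  refine ENNReal.tsum_le_tsum fun z => ?_
  calc c * g z = ∫⁻ _ in centeredCube n, c * g z := by simp [volume_centeredCube]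
    _ ≤ _ := setLIntegral_mono' measurableSet_centeredCube (h z)

theorem lintegral_le_tsum (g : (Fin n → ℤ) → ENNReal) (f : (Fin n → ℝ) → ENNReal)
    (h : ∀ z, ∀ q ∈ centeredCube n, f ((fun i => (z i : ℝ)) + q) ≤ g z) :
    ∫⁻ p, f p ≤ ∑' z, g z := by
  rw [lintegral_eq_tsum_centeredCube]
  refine ENNReal.tsum_le_tsum fun z => ?_
  calc _ ≤ ∫⁻ _ in centeredCube n, g z := setLIntegral_mono' measurableSet_centeredCube (h z)
    _ = g z := by simp [volume_centeredCube]

theorem Matrix.measurePreserving_mulVec_of_abs_det_eq_one {M : Matrix (Fin n) (Fin n) ℝ}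
    (hM : |M.det| = 1) : MeasurePreserving (fun p : Fin n → ℝ => M *ᵥ p) volume volume := by
  have h0 : M.det ≠ 0 := by
    intro h; simp [h] at hM
  have := Real.map_matrix_volume_pi_eq_smul_volume_pi h0
  rw [abs_inv, hM] at this
  refine ⟨(Matrix.toLin' M).continuous_of_finiteDimensional.measurable, ?_⟩
  rw [inv_one, ENNReal.ofReal_one, one_smul] at this
  exact this

theorem lintegral_smul_mulVec_add {M : Matrix (Fin n) (Fin n) ℝ} (hM : |M.det| = 1) {r : ℝ}
    (hr : 0 < r) (b : Fin n → ℝ) {f : (Fin n → ℝ) → ENNReal} (hf : Measurable f) :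
    ENNReal.ofReal (r ^ n) * ∫⁻ p, f (r • (M *ᵥ p) + b) = ∫⁻ p, f p := by
  have h1 := (Matrix.measurePreserving_mulVec_of_abs_det_eq_one hM).lintegral_comp
    (f := fun x => f (r • x + b)) (by fun_prop)
  have h2 := lintegral_map (μ := (volume : Measure (Fin n → ℝ))) (f := fun x => f (x + b))
    (g := fun x => r • x) (by fun_prop) (by fun_prop)
  rw [h1, ← h2, Measure.map_addHaar_smul _ hr.ne', lintegral_smul_measure,
    lintegral_add_right_eq_self, smul_eq_mul, ← mul_assoc, ← ENNReal.ofReal_mul (by positivity)]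
  simp only [finrank_fintype_fun_eq_card, Fintype.card_fin]
  rw [abs_of_pos (by positivity), mul_inv_cancel₀ (by positivity)]
  simp

end

/-! ### Comparison of mixed-integer volume with volume. -/

namespace MixedInteger

variable {n d : ℕ}

theorem intCast_mulVec (U : Matrix (Fin n) (Fin n) ℤ) (z : Fin n → ℤ) :
    (fun i => ((U *ᵥ z) i : ℝ)) = U.map (fun m : ℤ => (m : ℝ)) *ᵥ fun i => (z i : ℝ) := by
  ext i
  simp [Matrix.mulVec, dotProduct]

theorem abs_det_map_intCast {U : Matrix (Fin n) (Fin n) ℤ} (hU : |U.det| = 1) :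
    |(U.map (fun m : ℤ => (m : ℝ))).det| = 1 := by
  have : (U.map (fun m : ℤ => (m : ℝ))).det = (U.det : ℝ) :=
    (Int.cast_det (R := ℝ) U).symm
  rw [this, ← Int.cast_abs, hU, Int.cast_one]

theorem tsum_comp_mulVec {U : Matrix (Fin n) (Fin n) ℤ} (hU : |U.det| = 1)
    (g : (Fin n → ℤ) → ENNReal) : ∑' z, g (U *ᵥ z) = ∑' z, g z := by
  have hu : IsUnit U.det := Int.isUnit_iff_abs_eq.2 hU
  let e : (Fin n → ℤ) ≃ (Fin n → ℤ) :=
    { toFun := fun z => U *ᵥ z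
      invFun := fun z => U⁻¹ *ᵥ z
      left_inv := fun z => by simp [Matrix.mulVec_mulVec, Matrix.nonsing_inv_mul _ hu]
      right_inv := fun z => by simp [Matrix.mulVec_mulVec, Matrix.mul_nonsing_inv _ hu] }
  exact e.tsum_eq g

theorem mixedVolume_eq_tsum_mulVec {U : Matrix (Fin n) (Fin n) ℤ} (hU : |U.det| = 1)
    (A : Set (Space n d)) : mixedVolume A =
      ∑' z : Fin n → ℤ, volume (fiber A (U.map (fun m : ℤ => (m : ℝ)) *ᵥ fun i => (z i : ℝ))) := by
  rw [mixedVolume, ← tsum_comp_mulVec hU]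
  simp only [intCast_mulVec]

theorem mixedVolume_inter_lattice (A : Set (Space n d)) :
    mixedVolume (A ∩ lattice n d) = mixedVolume A := by
  unfold mixedVolume
  congr! 3 with z
  ext x
  exact ⟨fun h => h.1, fun h => ⟨h, z, fun i => rfl⟩⟩

theorem volume_eq_lintegral_fiber {A : Set (Space n d)} (hA : MeasurableSet A) :
    volume A = ∫⁻ p, volume (fiber A p) :=
  Measure.prod_apply hA

theorem measurable_volume_fiber {A : Set (Space n d)} (hA : MeasurableSet A) :
    Measurable fun p => volume (fiber A p) :=
  measurable_measure_prodMk_left hA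

theorem exists_mem_fst_eq {C : Set (Space n d)} {z₀ : Fin n → ℝ} {k : ℝ}
    {U : Matrix (Fin n) (Fin n) ℤ} (hcube : affineCube z₀ k U ⊆ proj C) {u : Fin n → ℝ}
    (hu : u ∈ cube n) :
    ∃ v ∈ C, v.1 = z₀ + k • (U.map (fun m : ℤ => (m : ℝ)) *ᵥ u) :=
  hcube ⟨u, hu, rfl⟩

theorem smul_mem_cube {q : Fin n → ℝ} (hq : q ∈ centeredCube n) {c : ℝ} (hc : |c| = 2) :
    c • q ∈ cube n := by
  intro i
  have h := hq i (mem_univ i)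
  rw [Pi.smul_apply, smul_eq_mul, abs_mul, hc]
  have : |q i| ≤ 1 / 2 := abs_le.2 ⟨h.1, h.2.le⟩
  linarith

/-- Filling the cells `U (z + [-1/2, 1/2)ⁿ)` by contractions of the lattice fibers of `C`. -/
theorem mul_mixedVolume_le_volume {C : Set (Space n d)} (hC : MeasurableSet C)
    (hconv : Convex ℝ C) {z₀ : Fin n → ℝ} {k ε : ℝ} {U : Matrix (Fin n) (Fin n) ℤ}
    (hU : |U.det| = 1) (hcube : affineCube z₀ k U ⊆ proj C) (h₀ : 0 < ε) (h₁ : ε < 1)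
    (hk : 2 * (ε * k) = 1 - ε) :
    ENNReal.ofReal ((1 - ε) ^ (n + d)) * mixedVolume C ≤ volume C := by
  set M := U.map (fun m : ℤ => (m : ℝ))
  have h₁' : 0 < 1 - ε := sub_pos.2 h₁
  have key := mul_tsum_le_lintegral (ENNReal.ofReal ((1 - ε) ^ d))
    (fun z : Fin n → ℤ => volume (fiber C (M *ᵥ fun i => (z i : ℝ))))
    (fun p => volume (fiber C ((1 - ε) • (M *ᵥ p) + ε • z₀))) (by
      intro z q hq
      -- The point v lies over z₀ + 2kMq; as 2εk = 1 - ε, contraction towards it carries the fiber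
      -- over Mz into the one over (1 - ε)M(z + q) + εz₀.
      obtain ⟨v, hv, hv1⟩ := exists_mem_fst_eq hcube (smul_mem_cube hq (c := 2) (by norm_num))
      have := ofReal_pow_finrank_mul_addHaar_le (volume : Measure (Fin d → ℝ)) h₁.le
        (A := fiber C (M *ᵥ fun i => (z i : ℝ)))
        (B := fiber C ((1 - ε) • (M *ᵥ ((fun i => (z i : ℝ)) + q)) + ε • z₀)) v.2 (by
          intro x hx
          have hmem := hconv hx hv h₁'.le h₀.le (by ring)
          have heq : (1 - ε) • (M *ᵥ ((fun i => (z i : ℝ)) + q)) + ε • z₀ =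
              (1 - ε) • (M *ᵥ fun i => (z i : ℝ)) + ε • v.1 := by
            rw [hv1, Matrix.mulVec_add, Matrix.mulVec_smul, ← hk]
            module
          change (_, _) ∈ C
          rw [heq]
          exact hmem)
      simpa using this)
  rw [← mixedVolume_eq_tsum_mulVec hU] at key
  rw [volume_eq_lintegral_fiber hC, ← lintegral_smul_mulVec_add (abs_det_map_intCast hU) h₁'
    (ε • z₀) (measurable_volume_fiber hC), pow_add, ENNReal.ofReal_mul (by positivity), mul_assoc]
  gcongr

/-- Covering the lattice fibers of `A` by contractions of the cells of `B`. -/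
theorem mul_volume_le_mixedVolume {A B C : Set (Space n d)} (hB : MeasurableSet B)
    {z₀ : Fin n → ℝ} {k ε : ℝ} {U : Matrix (Fin n) (Fin n) ℤ}
    (hU : |U.det| = 1) (hcube : affineCube z₀ k U ⊆ proj C) (h₁ : ε < 1)
    (hk : 2 * (ε * k) = 1) (hBA : ∀ y ∈ B, ∀ v ∈ C, (1 - ε) • y + ε • v ∈ A) :
    ENNReal.ofReal ((1 - ε) ^ (n + d)) * volume B ≤ mixedVolume A := by
  set M := U.map (fun m : ℤ => (m : ℝ))
  have h₁' : 0 < 1 - ε := sub_pos.2 h₁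
  have hr : 0 < (1 - ε)⁻¹ := inv_pos.2 h₁'
  set b : Fin n → ℝ := -((1 - ε)⁻¹ * ε) • z₀ with hb
  have key := lintegral_le_tsum
    (fun z : Fin n → ℤ => volume (fiber A (M *ᵥ fun i => (z i : ℝ))))
    (fun p => ENNReal.ofReal ((1 - ε) ^ d) * volume (fiber B ((1 - ε)⁻¹ • (M *ᵥ p) + b))) (by
      intro z q hq
      -- The opposite sign undoes the offset: as 2εk = 1, contraction towards v over z₀ - 2kMq lands
      -- exactly over Mz.
      obtain ⟨v, hv, hv1⟩ := exists_mem_fst_eq hcube (smul_mem_cube hq (c := -2) (by norm_num))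
      have := ofReal_pow_finrank_mul_addHaar_le (volume : Measure (Fin d → ℝ)) h₁.le
        (A := fiber B ((1 - ε)⁻¹ • (M *ᵥ ((fun i => (z i : ℝ)) + q)) + b))
        (B := fiber A (M *ᵥ fun i => (z i : ℝ))) v.2 (by
          intro x hx
          have hmem := hBA _ hx v hv
          have heq : (1 - ε) • ((1 - ε)⁻¹ • (M *ᵥ ((fun i => (z i : ℝ)) + q)) + b) + ε • v.1 =
              M *ᵥ fun i => (z i : ℝ) := by
            have e1 : (1 - ε) * (1 - ε)⁻¹ = 1 := mul_inv_cancel₀ h₁'.ne'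
            have e2 : (1 - ε) * -((1 - ε)⁻¹ * ε) = -ε := by linear_combination (-ε) * e1
            rw [hv1, hb, Matrix.mulVec_add, Matrix.mulVec_smul, smul_add, smul_smul, smul_smul,
              e1, e2]
            have e3 : ε • (z₀ + k • (-2 : ℝ) • (M *ᵥ q)) =
                ε • z₀ - (2 * (ε * k)) • (M *ᵥ q) := by module
            rw [e3, hk]
            module
          change (_, _) ∈ A
          rw [← heq]
          exact hmem)
      simpa using this)
  rw [← mixedVolume_eq_tsum_mulVec hU] at key
  refine le_trans ?_ key
  have hm : Measurable fun p => volume (fiber B ((1 - ε)⁻¹ • (M *ᵥ p) + b)) :=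
    (measurable_volume_fiber hB).comp (by
      have := (Matrix.measurePreserving_mulVec_of_abs_det_eq_one
        (abs_det_map_intCast hU)).measurable
      fun_prop)
  rw [lintegral_const_mul _ hm, volume_eq_lintegral_fiber hB,
    ← lintegral_smul_mulVec_add (abs_det_map_intCast hU) hr b (measurable_volume_fiber hB),
    pow_add, ENNReal.ofReal_mul (by positivity), ← mul_assoc, mul_right_comm (ENNReal.ofReal _),
    ← ENNReal.ofReal_mul (by positivity), ← mul_pow, mul_inv_cancel₀ h₁'.ne',
    one_pow, ENNReal.ofReal_one, one_mul]

end MixedInteger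

/-! ### The constant, and the lattice point near the centroid. -/

theorem centerpoint_constant_le {N : ℕ} (hN : 0 < N) {t : ℝ} (ht : 0 < t)
    (hNt : 3 * (N * t) ≤ Real.exp (-1)) :
    (Real.exp (-1) - 3 * (N * t)) * (1 + t) ^ N ≤
      (1 - t) ^ N * (Real.exp (-1) -
        N * (t / (1 - t)) / (1 + t / (1 - t) - N * (t / (1 - t)))) := by
  have hN' : (1 : ℝ) ≤ N := by exact_mod_cast hN
  have he := Real.exp_neg_one_lt_d9
  set e := Real.exp (-1)
  have htx : t ≤ N * t := by nlinarith
  set x := N * t with hx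
  have hx8 : x ≤ 1 / 8 := by linarith
  have ht1 : 0 < 1 - t := by linarith
  have hx1 : 0 < 1 - x := by linarith
  have hδ : N * (t / (1 - t)) / (1 + t / (1 - t) - N * (t / (1 - t))) = x / (1 - x) := by
    have h1 : 1 + t / (1 - t) - N * (t / (1 - t)) = (1 - x) / (1 - t) := by
      rw [hx]; field_simp; ring
    rw [h1, hx]
    field_simp
  rw [hδ]
  have hδ' : x / (1 - x) ≤ 8 / 7 * x := by
    rw [div_le_iff₀ hx1]; nlinarith
  set δ := x / (1 - x)
  have hx0 : 0 ≤ x := ht.le.trans htx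
  -- Bernoulli for (1 - 2t)^N, combined with (1 - 2t)(1 + t) ≤ 1 - t.
  have hbern : (1 - 2 * x) * (1 + t) ^ N ≤ (1 - t) ^ N := by
    have h1 := one_add_mul_le_pow (show (-2 : ℝ) ≤ -(2 * t) by linarith) N
    calc (1 - 2 * x) * (1 + t) ^ N ≤ (1 + -(2 * t)) ^ N * (1 + t) ^ N := by
          gcongr; rw [hx]; linarith
      _ = ((1 + -(2 * t)) * (1 + t)) ^ N := (mul_pow _ _ _).symm
      _ ≤ (1 - t) ^ N := pow_le_pow_left₀ (by nlinarith) (by nlinarith) N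
  have hκ : e - 3 * x ≤ (1 - 2 * x) * (e - δ) := by nlinarith
  calc (e - 3 * x) * (1 + t) ^ N ≤ (1 - 2 * x) * (e - δ) * (1 + t) ^ N := by gcongr
    _ = (1 - 2 * x) * (1 + t) ^ N * (e - δ) := by ring
    _ ≤ (1 - t) ^ N * (e - δ) := by
      refine mul_le_mul_of_nonneg_right hbern ?_
      linarith

namespace MixedInteger

variable {n d : ℕ}

instance : (volume : Measure (Space n d)).IsAddHaarMeasure :=
  Measure.prod.instIsAddHaarMeasure volume volume

/-- The linear functional `y ↦ aᵀ y`. -/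
def dotCLM (a : Space n d) : Space n d →L[ℝ] ℝ :=
  LinearMap.toContinuousLinearMap
    { toFun := fun y => a.1 ⬝ᵥ y.1 + a.2 ⬝ᵥ y.2
      map_add' := fun x y => by simp only [Prod.fst_add, Prod.snd_add, dotProduct_add]; ring
      map_smul' := fun r y => by simp [dotProduct_smul, mul_add] }

/-- A point of `C` whose projection lies within the cell around a given point can be moved to a
point of the mixed-integer lattice, by a contraction towards a point of `C`. -/
theorem exists_contraction_mem_lattice {C : Set (Space n d)} {z₀ : Fin n → ℝ} {k t : ℝ}
    {U : Matrix (Fin n) (Fin n) ℤ} (hU : |U.det| = 1) (hcube : affineCube z₀ k U ⊆ proj C)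
    (htk : 2 * (t * k) = 1) (c : Space n d) :
    ∃ v ∈ C, (1 - t) • c + t • v ∈ lattice n d := by
  set M := U.map (fun m : ℤ => (m : ℝ)) with hM
  have hdet : IsUnit M.det := by
    rw [isUnit_iff_ne_zero]
    intro h
    have := abs_det_map_intCast hU
    rw [h] at this
    simp at this
  -- Round the contracted projection in the coordinates of M; the rounding error q has entries at
  -- most 1/2, and v over z₀ + 2kMq supplies exactly Mq since 2tk = 1.
  set p := M⁻¹ *ᵥ ((1 - t) • c.1 + t • z₀)
  have hp : M *ᵥ p = (1 - t) • c.1 + t • z₀ := by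
    simp [p, Matrix.mulVec_mulVec, Matrix.mul_nonsing_inv _ hdet]
  set z : Fin n → ℤ := fun i => round (p i)
  set q : Fin n → ℝ := (fun i => (z i : ℝ)) - p with hq
  have hu : (2 : ℝ) • q ∈ cube n := by
    intro i
    have := abs_sub_round (p i)
    rw [abs_sub_comm] at this
    rw [Pi.smul_apply, smul_eq_mul, abs_mul, abs_two]
    change 2 * |(round (p i) : ℝ) - p i| ≤ 1
    linarith
  obtain ⟨v, hv, hv1⟩ := exists_mem_fst_eq hcube hu
  refine ⟨v, hv, U *ᵥ z, fun i => ?_⟩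
  have h1 : ((1 - t) • c + t • v).1 = M *ᵥ fun i => (z i : ℝ) := by
    have h2 : t • (z₀ + k • (2 : ℝ) • (M *ᵥ q)) = t • z₀ + (2 * (t * k)) • (M *ᵥ q) := by module
    rw [Prod.fst_add, Prod.smul_fst, Prod.smul_fst, hv1, Matrix.mulVec_smul, ← hM, h2, htk,
      one_smul, ← add_assoc, ← hp, ← Matrix.mulVec_add, hq, add_sub_cancel]
  rw [h1]
  exact (congrFun (intCast_mulVec U z) i).symm

/-- The approximate centroid of `C` cuts off a large mixed-integer volume. -/
theorem le_mixedVolume_inter_halfspace (hd : 0 < n + d) {C : Set (Space n d)}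
    (hC : IsConvexBody C) {z₀ : Fin n → ℝ} {k t : ℝ} {U : Matrix (Fin n) (Fin n) ℤ}
    (hU : |U.det| = 1) (hcube : affineCube z₀ k U ⊆ proj C)
    (ht : 0 < t) (htk : 2 * (t * k) = 1) (hNt : 3 * ((n + d : ℕ) * t) ≤ Real.exp (-1))
    {w : Space n d} (hw : w ∈ C) (l : Space n d →L[ℝ] ℝ) {c₀ : ℝ}
    (hc₀ : c₀ ≤ l ((1 - t) • (⨍ y in C, y) + t • w)) :
    ENNReal.ofReal (Real.exp (-1) - 3 * ((n + d : ℕ) * t)) * mixedVolume C ≤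
      mixedVolume (C ∩ {y | c₀ ≤ l y}) := by
  have hcomp := hC.isCompact
  have hvol : volume C ≠ 0 := (Measure.measure_pos_of_nonempty_interior _ hC.interior_nonempty).ne'
  have hfin : finrank ℝ (Space n d) = n + d := by simp
  have hN' : (1 : ℝ) ≤ (n + d : ℕ) := by exact_mod_cast hd
  have htx : t ≤ (n + d : ℕ) * t := by nlinarith
  have he := Real.exp_neg_one_lt_d9
  have ht1 : 0 < 1 - t := by linarith
  obtain ⟨u, hu, hu'⟩ := hcomp.exists_isMinOn ⟨w, hw⟩ l.continuous.continuousOn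
  obtain ⟨v, hv, hv'⟩ := hcomp.exists_isMaxOn ⟨w, hw⟩ l.continuous.continuousOn
  have hu' : ∀ y ∈ C, l u ≤ l y := fun y hy => hu' hy
  have hv' : ∀ y ∈ C, l y ≤ l v := fun y hy => hv' hy
  set c := ⨍ y in C, y
  -- Chosen so that, for y in B and x in C, (1 - t) l y + t l x ≥ (1 - t) l c + t max l ≥ c₀, the
  -- extra t(max l - min l) absorbing the worst x.
  set s := t / (1 - t) with hs
  have hst : (1 - t) * s = t := by rw [hs]; field_simp
  set N := n + d
  have hshift := grunbaum_shift volume (hfin ▸ hd) hcomp hC.convex hvol l hu hv (hu' v hv)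
    (s := s) (by positivity) (by
      rw [hfin, ← mul_lt_mul_iff_right₀ ht1]
      calc (1 - t) * (N * s) = N * ((1 - t) * s) := by ring
        _ < (1 - t) + (1 - t) * s := by rw [hst]; linarith
        _ = _ := by ring)
  rw [hfin] at hshift
  set B := C ∩ {y | l c + s * (l v - l u) ≤ l y} with hB
  have hBm : MeasurableSet B := (hcomp.measurableSet).inter
    (measurableSet_le measurable_const l.continuous.measurable)
  have hlow := mul_volume_le_mixedVolume (A := C ∩ {y | c₀ ≤ l y}) hBm hU hcube
    (by linarith : t < 1) htk (by
      rintro y ⟨hy, hly⟩ x hx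
      refine ⟨hC.convex hy hx ht1.le ht.le (by ring), ?_⟩
      have hly : l c + s * (l v - l u) ≤ l y := hly
      have h1 := mul_le_mul_of_nonneg_left hly ht1.le
      have h2 : (1 - t) * (l c + s * (l v - l u)) = (1 - t) * l c + t * (l v - l u) := by
        rw [mul_add, ← mul_assoc, hst]
      have h3 := mul_le_mul_of_nonneg_left (hu' x hx) ht.le
      have h4 := mul_le_mul_of_nonneg_left (hv' w hw) ht.le
      simp only [map_add, map_smul, smul_eq_mul, mem_ofPred_eq] at hc₀ ⊢
      linarith)
  -- The weight t/(1 + t) solves 2εk = 1 - ε, and then 1 - ε = 1/(1 + t).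
  have hup := mul_mixedVolume_le_volume hcomp.measurableSet hC.convex hU hcube
    (ε := t / (1 + t)) (by positivity) ((div_lt_one (by positivity)).2 (by linarith)) (by
      have : 1 - t / (1 + t) = 1 / (1 + t) := by field_simp; ring
      rw [this, ← htk]; field_simp)
  have hup' : mixedVolume C ≤ ENNReal.ofReal ((1 + t) ^ N) * volume C := by
    have h1 : (1 + t) * (1 - t / (1 + t)) = 1 := by field_simp; ring
    calc mixedVolume C = ENNReal.ofReal ((1 + t) ^ N) *
          (ENNReal.ofReal ((1 - t / (1 + t)) ^ N) * mixedVolume C) := by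
          rw [← mul_assoc, ← ENNReal.ofReal_mul (by positivity), ← mul_pow, h1]
          simp
      _ ≤ _ := by gcongr
  have hconst := centerpoint_constant_le hd ht hNt
  refine le_trans ?_ hlow
  calc ENNReal.ofReal (Real.exp (-1) - 3 * (N * t)) * mixedVolume C
      ≤ ENNReal.ofReal (Real.exp (-1) - 3 * (N * t)) *
          (ENNReal.ofReal ((1 + t) ^ N) * volume C) := by gcongr
    _ = ENNReal.ofReal ((Real.exp (-1) - 3 * (N * t)) * (1 + t) ^ N * volume.real C) := by
        rw [ENNReal.ofReal_mul' measureReal_nonneg, ENNReal.ofReal_mul' (by positivity),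
          ofReal_measureReal hcomp.measure_ne_top, mul_assoc]
    _ ≤ ENNReal.ofReal ((1 - t) ^ N * volume.real B) := by
        refine ENNReal.ofReal_le_ofReal ?_
        calc _ ≤ _ := mul_le_mul_of_nonneg_right hconst measureReal_nonneg
          _ ≤ _ := by
            rw [mul_assoc]
            exact mul_le_mul_of_nonneg_left hshift (by positivity)
    _ = ENNReal.ofReal ((1 - t) ^ N) * volume B := by
        rw [ENNReal.ofReal_mul (by positivity), ofReal_measureReal
          (measure_ne_top_of_subset inter_subset_left hcomp.measure_ne_top)]

end MixedInteger

end

/-! ### The theorem. -/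

theorem corollary2 (n d : ℕ) (hn : 0 < n) (hd : 0 < d)
    (C : Set (MixedInteger.Space n d)) (hC : MixedInteger.IsConvexBody C)
    (z₀ : Fin n → ℝ) (k : ℝ) (hk : 3 * Real.exp 1 / 2 * ((n : ℝ) + (d : ℝ)) ≤ k)
    (U : Matrix (Fin n) (Fin n) ℤ) (hU : |U.det| = 1)
    (hcube : MixedInteger.affineCube z₀ k U ⊆ MixedInteger.proj C) :
    ∃ y ∈ C ∩ MixedInteger.lattice n d,
      ∀ H : Set (MixedInteger.Space n d), MixedInteger.IsClosedHalfspace H → y ∈ H →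
        ENNReal.ofReal (1 / Real.exp 1 - 3 * ((n : ℝ) + (d : ℝ)) / (2 * k)) *
            MixedInteger.mixedVolume (C ∩ MixedInteger.lattice n d) ≤
          MixedInteger.mixedVolume ((C ∩ MixedInteger.lattice n d) ∩ H) := by
  have hN : (0 : ℝ) < (n : ℝ) + d := by positivity
  have hk0 : 0 < k := lt_of_lt_of_le (by positivity) hk
  set t := 1 / (2 * k) with ht
  have ht0 : 0 < t := by positivity
  have htk : 2 * (t * k) = 1 := by rw [ht]; field_simp
  have hexp : Real.exp (-1) = 1 / Real.exp 1 := by rw [Real.exp_neg, one_div]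
  -- This is the lower bound on k; it says that the final constant is nonnegative.
  have hNt : 3 * (((n + d : ℕ) : ℝ) * t) ≤ Real.exp (-1) := by
    rw [hexp, le_div_iff₀ (Real.exp_pos 1)]
    push_cast
    calc 3 * (((n : ℝ) + d) * t) * Real.exp 1
        = 2 * (t * (3 * Real.exp 1 / 2 * ((n : ℝ) + d))) := by ring
      _ ≤ 2 * (t * k) := by gcongr
      _ = 1 := htk
  have ht1 : t ≤ 1 := by
    have he := Real.exp_neg_one_lt_d9
    have h1 : (1 : ℝ) ≤ (n + d : ℕ) := by exact_mod_cast (by omega : 1 ≤ n + d)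
    nlinarith
  have hvol : MeasureTheory.volume C ≠ 0 :=
    (MeasureTheory.Measure.measure_pos_of_nonempty_interior _ hC.interior_nonempty).ne'
  have hc : (⨍ y in C, y) ∈ C := by
    refine hC.convex.set_average_mem hC.isCompact.isClosed hvol hC.isCompact.measure_ne_top ?_
      (continuousOn_id.integrableOn_compact hC.isCompact)
    exact MeasureTheory.ae_restrict_mem hC.isCompact.measurableSet
  obtain ⟨w, hw, hlat⟩ := MixedInteger.exists_contraction_mem_lattice hU hcube htk (⨍ y in C, y)
  refine ⟨_, ⟨hC.convex hc hw (sub_nonneg.2 ht1) ht0.le (by ring), hlat⟩, ?_⟩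
  rintro H ⟨a, c₀, -, rfl⟩ hy
  have key := MixedInteger.le_mixedVolume_inter_halfspace (by omega) hC hU hcube ht0 htk hNt hw
    (MixedInteger.dotCLM a) (c₀ := c₀) hy
  have hκ : 1 / Real.exp 1 - 3 * ((n : ℝ) + (d : ℝ)) / (2 * k) =
      Real.exp (-1) - 3 * ((n + d : ℕ) * t) := by
    rw [hexp, ht]; push_cast; ring
  rw [Set.inter_right_comm, MixedInteger.mixedVolume_inter_lattice,
    MixedInteger.mixedVolume_inter_lattice, hκ]
  exact key
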